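/- A finite simple graph $G=(V,E)$ is word-representable if there is a word $w$ over the alphabet $V$, containing each letter of $V$, such that for all distinct $x,y\in V$ the letters $x$ and $y$ alternate in $w$ (that is, deleting all other letters from $w$ leaves $xyxy\cdots$ or $yxyx\cdots$) if and only if $xy\in E$. Let $T^\infty$ be the infinite triangular tiling graph of the plane (vertices $(x+\frac y2,\frac{\sqrt3}{2}y)$, $x,y\in\mathbb Z$, adjacent when at distance $1$); its triangular faces are called cells. A triangular grid graph $G$ is the subgraph of $T^\infty$ formed by all edges (and their endpoints) bounding finitely many given cells. A cell belongs to $G$ if all three of its edges are edges of $G$. An edge of $G$ is a boundary edge if it is also an edge of a cell of $T^\infty$ that does not belong to $G$, and a cell belonging to $G$ is a boundary cell if at least one of its edges is a boundary edge. For a set $S$ of cells belonging to $G$, the subdivision of $S$ is the graph obtained from $G$ by adding, for each $c\in S$, a new vertex adjacent exactly to the three vertices of $c$. It is a word-representable subdivision of $G$ if the resulting graph is word-representable, and it is then maximal if subdividing in addition any one further cell of $G$ results in a non-word-representable graph. The Sierpiński gasket graph $SG(n)$, $n\ge 0$, is the triangular grid graph defined recursively as follows: $SG(0)$ is a single cell,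 and $SG(n+1)$ is the juxtaposition of three copies of $SG(n)$ (each of the shape of an equilateral triangle of side $2^n$), placed in the three corners of an equilateral triangle of side $2^{n+1}$. **Theorem.** For every $n\ge 0$: 1. for every set $S$ of boundary cells of $SG(n)$, the subdivision of $S$ in $SG(n)$ is word-representable; 2. subdividing all boundary cells of $SG(n)$ gives its maximum word-representable subdivision: it is a maximal word-representable subdivision of $SG(n)$, it is the only maximal one, and every set $S$ of cells belonging to $SG(n)$ whose subdivision is word-representable consists of boundary cells only. -/

import Mathlib

namespace TriGrid

/-! ### Word-representable graphs -/

open Classical in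
/-- The distinct letters `x` and `y` alternate in `w`: after deleting all other letters, no letter is
followed by itself, so that what is left of `w` reads `xyxy⋯` or `yxyx⋯`. -/
def Alternate {V : Type*} (w : List V) (x y : V) : Prop :=
  (w.filter (fun z => z = x ∨ z = y)).IsChain (fun a b => a ≠ b)

/-- A graph is word-representable if there is a word over the alphabet `V` (in which every letter of
`V` occurs) such that distinct `x` and `y` alternate in it if and only if they are adjacent. -/
def WordRepresentable {V : Type*} (G : SimpleGraph V) : Prop :=
  ∃ w : List V, (∀ v : V, v ∈ w) ∧ ∀ x y : V, x ≠ y → (Alternate w x y ↔ G.Adj x y)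

/-! ### The triangular tiling graph and its cells -/

/-- The infinite triangular tiling graph. The vertex `(x, y)` stands for the point
`(x + y / 2, y * √3 / 2)` of the plane; two vertices are adjacent if and only if their Euclidean
distance is `1`, and the square of that distance is `dx ^ 2 + dx * dy + dy ^ 2`
(see `tiling_adj_iff_dist`). -/
def tiling : SimpleGraph (ℤ × ℤ) where
  Adj u v := (u.1 - v.1) ^ 2 + (u.1 - v.1) * (u.2 - v.2) + (u.2 - v.2) ^ 2 = 1
  symm := ⟨fun u v h => by linarith⟩
  loopless := ⟨fun u h => by simp at h⟩

/-- The point of the Euclidean plane represented by a vertex of the tiling. -/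
noncomputable def point (u : ℤ × ℤ) : EuclideanSpace ℝ (Fin 2) :=
  !₂[(u.1 : ℝ) + (u.2 : ℝ) / 2, (u.2 : ℝ) * Real.sqrt 3 / 2]

theorem tiling_adj_iff_dist (u v : ℤ × ℤ) :
    tiling.Adj u v ↔ dist (point u) (point v) = 1 := by
  have h3 : Real.sqrt 3 ^ 2 = 3 := Real.sq_sqrt (by norm_num)
  have key : ((u.1 : ℝ) + u.2 / 2 - (v.1 + v.2 / 2)) ^ 2
      + ((u.2 : ℝ) * Real.sqrt 3 / 2 - v.2 * Real.sqrt 3 / 2) ^ 2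
      = (((u.1 - v.1) ^ 2 + (u.1 - v.1) * (u.2 - v.2) + (u.2 - v.2) ^ 2 : ℤ) : ℝ) := by
    push_cast
    linear_combination ((u.2 : ℝ) - v.2) ^ 2 / 4 * h3
  rw [EuclideanSpace.dist_eq, Real.sqrt_eq_one]
  simp only [Fin.sum_univ_two, Real.dist_eq, sq_abs, point]
  simp only [Matrix.cons_val_zero, Matrix.cons_val_one]
  rw [key]
  norm_cast

/-- The cells, that is, the triangular faces of the tiling: `up x y` is the triangle with lower left
corner `(x, y)` and apex on top, `down x y` is the triangle adjacent to the right side of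
`up x y`. -/
inductive Cell where
  | up (x y : ℤ) : Cell
  | down (x y : ℤ) : Cell
  deriving DecidableEq

/-- The three vertices of a cell. -/
def Cell.verts : Cell → Finset (ℤ × ℤ)
  | .up x y => {(x, y), (x + 1, y), (x, y + 1)}
  | .down x y => {(x + 1, y), (x, y + 1), (x + 1, y + 1)}

/-- Translation of a cell by `(a, b)`. -/
def Cell.shift (a b : ℤ) : Cell → Cell
  | .up x y => .up (x + a) (y + b)
  | .down x y => .down (x + a) (y + b)

theorem Cell.tiling_adj (c : Cell) {u v : ℤ × ℤ} (hu : u ∈ c.verts) (hv : v ∈ c.verts)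
    (h : u ≠ v) : tiling.Adj u v := by
  cases c <;> simp only [Cell.verts, Finset.mem_insert, Finset.mem_singleton] at hu hv <;>
    rcases hu with rfl | rfl | rfl <;> rcases hv with rfl | rfl | rfl <;>
    first
    | exact absurd rfl h
    | (simp only [tiling]; ring)

/-! ### Triangular grid graphs -/

/-- The triangular grid graph specified by a finite set of cells: its edges are the edges bounding
the specified cells, its vertices are the endpoints of these edges. -/
def gridGraph (C : Finset Cell) : tiling.Subgraph where
  verts := {u | ∃ c ∈ C, u ∈ c.verts}
  Adj u v := u ≠ v ∧ ∃ c ∈ C, u ∈ c.verts ∧ v ∈ c.verts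
  adj_sub := fun ⟨h, c, _, hu, hv⟩ => c.tiling_adj hu hv h
  edge_vert := fun ⟨_, c, hc, hu, _⟩ => ⟨c, hc, hu⟩
  symm := ⟨fun _ _ ⟨h, c, hc, hu, hv⟩ => ⟨h.symm, c, hc, hv, hu⟩⟩

/-- The cells that belong to `G`: those all of whose edges are edges of `G`. -/
def cells (G : tiling.Subgraph) : Set Cell :=
  {c | ∀ u ∈ c.verts, ∀ v ∈ c.verts, u ≠ v → G.Adj u v}

/-- A boundary edge of `G` is an edge of `G` shared with a cell of the tiling that does not belong
to `G`. -/
def IsBoundaryEdge (G : tiling.Subgraph) (u v : ℤ × ℤ) : Prop :=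
  G.Adj u v ∧ ∃ c : Cell, u ∈ c.verts ∧ v ∈ c.verts ∧ c ∉ cells G

/-- The boundary cells of `G`: the cells belonging to `G` that are incident to at least one boundary
edge, i.e. one of their three edges is a boundary edge. -/
def boundaryCells (G : tiling.Subgraph) : Set Cell :=
  {c | c ∈ cells G ∧ ∃ u ∈ c.verts, ∃ v ∈ c.verts, IsBoundaryEdge G u v}

/-! ### Subdivisions -/

/-- The subdivision of the set `S` of cells of `G`: for every cell `c` in `S` a new vertex is added,
which is adjacent exactly to the three vertices of `c`. It is meant for sets `S` of cells that belong
to `G`. -/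
def subdivision (G : tiling.Subgraph) (S : Set Cell) : SimpleGraph (G.verts ⊕ S) where
  Adj
    | .inl u, .inl v => G.Adj u v
    | .inl u, .inr c => (u : ℤ × ℤ) ∈ (c : Cell).verts
    | .inr c, .inl u => (u : ℤ × ℤ) ∈ (c : Cell).verts
    | .inr _, .inr _ => False
  symm := ⟨by
    rintro (u | c) (v | d) h
    · exact G.adj_symm h
    · exact h
    · exact h
    · exact h⟩
  loopless := ⟨by
    rintro (u | c) h
    · exact G.loopless.irrefl _ h
    · exact h⟩

/-- Subdividing the cells in `S` is a word-representable subdivision of `G`. -/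
def IsWordRepSubdivision (G : tiling.Subgraph) (S : Set Cell) : Prop :=
  S ⊆ cells G ∧ WordRepresentable (subdivision G S)

/-- A word-representable subdivision is maximal if subdividing any other cell results in a
non-word-representable graph. -/
def IsMaximalWordRepSubdivision (G : tiling.Subgraph) (S : Set Cell) : Prop :=
  IsWordRepSubdivision G S ∧
    ∀ c ∈ cells G, c ∉ S → ¬ WordRepresentable (subdivision G (insert c S))

/-- The maximum word-representable subdivision: it is the unique maximal word-representable
subdivision, and every word-representable subdivision subdivides only cells in `S`. -/
def IsMaximumWordRepSubdivision (G : tiling.Subgraph) (S : Set Cell) : Prop :=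
  IsMaximalWordRepSubdivision G S ∧
    (∀ T : Set Cell, IsMaximalWordRepSubdivision G T → T = S) ∧
    ∀ T : Set Cell, IsWordRepSubdivision G T → T ⊆ S

/-! ### The Sierpiński gasket graph -/

/-- The cells specifying the Sierpiński gasket graph: stage `0` is a single cell, and stage `n + 1`
is the juxtaposition of three copies of stage `n` (an equilateral triangle of side `2 ^ n`) in the
three corners of an equilateral triangle of side `2 ^ (n + 1)`. -/
def gasketCells : ℕ → Finset Cell
  | 0 => {.up 0 0}
  | n + 1 => gasketCells n ∪ (gasketCells n).image (Cell.shift (2 ^ n) 0) ∪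
      (gasketCells n).image (Cell.shift 0 (2 ^ n))

/-- The two-dimensional Sierpiński gasket graph `SG(n)`. -/
def SG (n : ℕ) : tiling.Subgraph := gridGraph (gasketCells n)

end TriGrid

/-!
The argument rests on the correspondence between words and orientations without shortcuts.

*From words to orders.* Distinct letters alternate in a word if and only if one of them leads the
other: in each prefix it occurs as often as the other one or once more (`alternate_iff`). Ordering
letters by their counts in all prefixes therefore gives a preorder in which adjacent letters are
comparable, and if `b ≼ x ≼ y ≼ a` with `b` and `a` adjacent, then the counts of `x` and `y` differ
by at most one as well, so that `x` and `y` are adjacent (`WordRepresentable.exists_preorder`). A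
downward cell belonging to the gasket lies in the middle of three upward cells; when it is
subdivided, its vertices and the new vertex form a clique with three further vertices attached to
the edges of the cell. No preorder of this kind exists on these seven vertices
(`not_wordRepresentable_of_clique`).

*From orientations to words.* For an acyclic orientation, call a vector of letter counts a state if
along each arc the count drops by `0` or `1`. One can pass from any state to any larger one by
raising single letters (`IsState.exists_word`), hence a single word passes through any finite list
of states (`exists_word_through`). In this word the two ends of an arc alternate. If no directed
path has a shortcut, then for non-adjacent `x` and `y` there is a state in which the counts of `x`
and `y` violate alternation, so that the graph is word-representable
(`wordRepresentable_of_orientation`).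

*The gasket.* The tiling is properly coloured by `x - y` modulo `3`, and the edges are directed
from the smaller to the larger colour. The gasket consists of upward cells whose coordinates are
not both odd; by parity each of them is adjacent to at most one downward cell belonging to the
gasket (`outside_vertex_eq`). So the upward cells are exactly the boundary cells
(`boundaryCells_SG`), and the new vertex in an upward cell can be put into the linear order of the
three corners in such a way that no shortcut arises across the edge to the adjacent downward cell
(`wordRepresentable_of_apexes`).
-/

namespace TriGrid

/-! ### Alternation in terms of letter counts -/

section Words

open Classical

variable {V : Type*}

/-- In every prefix of `w` the letter `x` occurs as often as `y` or once more. For `x ≠ y` this says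
that `x` and `y` alternate in `w`, with `y` not coming first. -/
def Lead (w : List V) (x y : V) : Prop :=
  ∀ p, p <+: w → p.count y ≤ p.count x ∧ p.count x ≤ p.count y + 1

theorem lead_cons_left {x y : V} (h : x ≠ y) (w : List V) :
    Lead (x :: w) x y ↔ Lead w y x := by
  constructor
  · intro H p hp
    have := H (x :: p) (by simpa using hp)
    simp only [List.count_cons_self, List.count_cons_of_ne h] at this
    omega
  · intro H p hp
    rcases List.prefix_cons_iff.1 hp with rfl | ⟨t, rfl, ht⟩
    · simp
    · have := H t ht
      simp only [List.count_cons_self, List.count_cons_of_ne h]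
      omega

theorem not_lead_cons_right {x y : V} (h : x ≠ y) (w : List V) : ¬ Lead (y :: w) x y := by
  intro H
  have := H [y] (by simp)
  simp [List.count_cons_of_ne h.symm] at this

theorem lead_cons_of_ne {x y z : V} (hx : z ≠ x) (hy : z ≠ y) (w : List V) :
    Lead (z :: w) x y ↔ Lead w x y := by
  constructor
  · intro H p hp
    have := H (z :: p) (by simpa using hp)
    simpa only [List.count_cons_of_ne hx, List.count_cons_of_ne hy] using this
  · intro H p hp
    rcases List.prefix_cons_iff.1 hp with rfl | ⟨t, rfl, ht⟩
    · simp
    · have := H t ht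
      simpa only [List.count_cons_of_ne hx, List.count_cons_of_ne hy] using this

theorem alternate_comm (w : List V) (x y : V) : Alternate w x y ↔ Alternate w y x := by
  simp only [Alternate, or_comm]

theorem lead_iff (w : List V) : ∀ {x y : V}, x ≠ y →
    (Lead w x y ↔ Alternate w x y ∧ (w.filter (fun z => z = x ∨ z = y)).head? ≠ some y) := by
  induction w with
  | nil =>
    intro x y h
    simp only [Alternate, Lead]
    simp
  | cons z w ih =>
    intro x y h
    by_cases hx : z = x
    · subst hx
      rw [lead_cons_left h, ih h.symm, alternate_comm]
      simp only [Alternate, List.filter_cons, true_or, decide_true, if_true, List.isChain_cons,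
        List.head?_cons, ne_eq, Option.some.injEq, h, not_false_eq_true, and_true]
      rw [and_comm]
      simp only [or_comm (a := _ = y)]
      refine and_congr_left fun _ => ⟨fun H b hb e => H ?_, fun H e => H z e rfl⟩
      subst e
      exact hb
    · by_cases hy : z = y
      · subst hy
        simp [not_lead_cons_right h]
      · rw [lead_cons_of_ne hx hy, ih h]
        simp [Alternate, hx, hy]

theorem alternate_iff {w : List V} {x y : V} (h : x ≠ y) :
    Alternate w x y ↔ Lead w x y ∨ Lead w y x := by
  rw [lead_iff w h, lead_iff w h.symm, alternate_comm w y x]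
  constructor
  · intro H
    by_cases e : (w.filter (fun z => z = x ∨ z = y)).head? = some y
    · refine Or.inr ⟨H, ?_⟩
      simp only [or_comm (a := _ = y), e]
      simpa using h.symm
    · exact Or.inl ⟨H, e⟩
  · rintro (H | H) <;> exact H.1

/-! ### A necessary condition and an obstruction -/

/-- A word representing `G` yields a preorder in which adjacent vertices are comparable and which
has no shortcuts: `x ≼ y` means that no prefix of the word contains more letters `y` than `x`. -/
theorem WordRepresentable.exists_preorder {G : SimpleGraph V} (hG : WordRepresentable G) :
    ∃ D : V → V → Prop, (∀ x, D x x) ∧ (∀ x y z, D x y → D y z → D x z) ∧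
      (∀ x y, G.Adj x y → D x y ∨ D y x) ∧
      ∀ b x y a, G.Adj b a → D b x → D x y → D y a → x ≠ y → G.Adj x y := by
  obtain ⟨w, -, hw⟩ := hG
  refine ⟨fun x y => ∀ p, p <+: w → p.count y ≤ p.count x,
    fun x p _ => le_rfl, fun x y z h₁ h₂ p hp => (h₂ p hp).trans (h₁ p hp), fun x y h => ?_,
    fun b x y a h h₁ h₂ h₃ hxy => ?_⟩
  · rcases (alternate_iff h.ne).1 ((hw x y h.ne).2 h) with H | H
    · exact Or.inl fun p hp => (H p hp).1
    · exact Or.inr fun p hp => (H p hp).1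
  · refine (hw x y hxy).1 ((alternate_iff hxy).2 (Or.inl fun p hp => ⟨h₂ p hp, ?_⟩))
    have k₁ := h₁ p hp
    have k₂ := h₂ p hp
    have k₃ := h₃ p hp
    rcases (alternate_iff h.ne).1 ((hw b a h.ne).2 h) with H | H
    · have := (H p hp).2
      omega
    · have := (H p hp).1
      omega

/-- The obstruction: a clique `a, b, c, d` together with vertices `x, y, z` attached to the edges
`ac`, `ab`, `bc` of the triangle `abc`. -/
theorem not_wordRepresentable_of_clique {G : SimpleGraph V} {a b c d x y z : V}
    (hab : G.Adj a b) (hac : G.Adj a c) (hbc : G.Adj b c)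
    (hda : G.Adj d a) (hdb : G.Adj d b) (hdc : G.Adj d c)
    (hxa : G.Adj x a) (hxc : G.Adj x c) (hxb : ¬ G.Adj x b) (hxd : ¬ G.Adj x d)
    (hya : G.Adj y a) (hyb : G.Adj y b) (hyc : ¬ G.Adj y c) (hyd : ¬ G.Adj y d)
    (hzb : G.Adj z b) (hzc : G.Adj z c) (hza : ¬ G.Adj z a) (hzd : ¬ G.Adj z d) :
    ¬ WordRepresentable G := by
  intro hG
  obtain ⟨D, rf, tr, tot, st⟩ := hG.exists_preorder
  -- A vertex attached to the outer two of three ordered clique vertices lies between them.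
  have btw : ∀ {u v w t : V}, D u v → D v w → G.Adj t u → G.Adj t w → ¬ G.Adj t v → t ≠ v →
      D u t ∧ D t w := by
    intro u v w t h₁ h₂ hu hw hv htv
    constructor
    · refine (tot t u hu).resolve_left fun h => ?_
      exact hv (st t t v w hw (rf t) (tr _ _ _ h h₁) h₂ htv)
    · refine (tot t w hw).resolve_right fun h => ?_
      exact hv (st u v t t hu.symm h₁ (tr _ _ _ h₂ h) (rf t) htv.symm).symm
  -- Suppose that the triangle is ordered as `p ≼ q ≼ r`. Then `x`, and with it `d`, lies between
  -- `p` and `r`; according to the place of `d` with respect to `q`, one of `y` and `z` has none left.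
  have main : ∀ {p q r x y z : V}, D p q → D q r → G.Adj p r →
      G.Adj d p → G.Adj d q → G.Adj d r →
      G.Adj x p → G.Adj x r → ¬ G.Adj x q → ¬ G.Adj x d →
      G.Adj y p → G.Adj y q → ¬ G.Adj y r → ¬ G.Adj y d →
      G.Adj z q → G.Adj z r → ¬ G.Adj z p → ¬ G.Adj z d → False := by
    intro p q r x y z Dpq Dqr hpr hdp hdq hdr hxp hxr hxq hxd hyp hyq hyr hyd hzq hzr hzp hzd
    have ne {s t v : V} (h₁ : G.Adj s v) (h₂ : ¬ G.Adj t v) : t ≠ s := by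
      rintro rfl
      exact h₂ h₁
    obtain ⟨px, xr⟩ := btw Dpq Dqr hxp hxr hxq (ne hdq.symm hxd)
    have pd : D p d := (tot d p hdp).resolve_left fun h =>
      hxd (st d d x r hdr (rf d) (tr _ _ _ h px) xr (ne hdq hxq).symm).symm
    have dr : D d r := (tot d r hdr).resolve_right fun h =>
      hxd (st p x d d hdp.symm px (tr _ _ _ xr h) (rf d) (ne hdq hxq))
    rcases tot d q hdq with h | h
    · obtain ⟨py, yq⟩ := btw pd h hyp hyq hyd (ne hdr hyr)
      exact hyr (st p y r r hpr py (tr _ _ _ yq Dqr) (rf r) (ne hdr.symm hyd))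
    · obtain ⟨qz, zr⟩ := btw h dr hzq hzr hzd (ne hdp hzp)
      exact hzp (st p p z r hpr (rf p) (tr _ _ _ Dpq qz) zr (ne hdp.symm hzd).symm).symm
  rcases tot a b hab with h₁ | h₁ <;> rcases tot b c hbc with h₂ | h₂
  · exact main h₁ h₂ hac hda hdb hdc hxa hxc hxb hxd hya hyb hyc hyd hzb hzc hza hzd
  · rcases tot a c hac with h₃ | h₃
    · exact main h₃ h₂ hab hda hdc hdb hya hyb hyc hyd hxa hxc hxb hxd hzc hzb hza hzd
    · exact main h₃ h₁ hbc.symm hdc hda hdb hzc hzb hza hzd hxc hxa hxb hxd hya hyb hyc hyd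
  · rcases tot a c hac with h₃ | h₃
    · exact main h₁ h₃ hbc hdb hda hdc hzb hzc hza hzd hyb hya hyc hyd hxa hxc hxb hxd
    · exact main h₂ h₃ hab.symm hdb hdc hda hyb hya hyc hyd hzb hzc hza hzd hxc hxa hxb hxd
  · exact main h₂ h₁ hac.symm hdc hdb hda hxc hxa hxb hxd hzc hzb hza hzd hyb hya hyc hyd

/-! ### Words from shortcut-free orientations -/

/-- The letter counts reached while a word is written in which `u` leads `v` for every arc
`R u v`: along each arc the count drops by `0` or `1`. -/
def IsState (R : V → V → Prop) (h : V → ℕ) : Prop :=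
  ∀ u v, R u v → h v ≤ h u ∧ h u ≤ h v + 1

/-- One passes from a state to any larger state by raising single letters, through states only. -/
theorem IsState.exists_word [Finite V] {R : V → V → Prop} {rank : V → ℕ}
    (hR : ∀ u v, R u v → rank u < rank v) {g h : V → ℕ} (hg : IsState R g) (hh : IsState R h)
    (hgh : g ≤ h) :
    ∃ w : List V, (∀ v, g v + w.count v = h v) ∧
      ∀ p, p <+: w → IsState R fun v => g v + p.count v := by
  have := Fintype.ofFinite V
  induction hn : ∑ v, (h v - g v) using Nat.strong_induction_on generalizing g with | _ n ih
  subst hn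
  rcases (Finset.univ.filter fun v => g v < h v).eq_empty_or_nonempty with he | hne
  · rw [Finset.filter_eq_empty_iff] at he
    refine ⟨[], fun v => ?_, fun p hp => ?_⟩
    · simpa using le_antisymm (hgh v) (not_lt.1 (he (Finset.mem_univ v)))
    · simpa [List.prefix_nil.1 hp] using hg
  · -- A letter that still has to be raised may be raised next if its count is least, and among
    -- these its rank.
    obtain ⟨v, hv, hmin⟩ := Finset.exists_min_image _ (fun v => toLex (g v, rank v)) hne
    simp only [Finset.mem_filter, Finset.mem_univ, true_and, Prod.Lex.toLex_le_toLex] at hv hmin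
    have hcount : ∀ u, List.count u [v] = if u = v then 1 else 0 := by
      intro u
      by_cases hu : u = v
      · simp [hu]
      · simp [hu, Ne.symm hu]
    have hg' : IsState R fun u => g u + List.count u [v] := by
      intro a b hab
      have h₁ := hg a b hab
      have h₂ := hh a b hab
      have h₃ := hR a b hab
      have h₄ := hmin a
      have h₅ := hmin b
      simp only [hcount]
      split_ifs with ha hb hb
      · omega
      · subst ha
        omega
      · subst hb
        omega
      · omega
    have hle : (fun u => g u + List.count u [v]) ≤ h := by
      intro u
      have := hgh u
      simp only [hcount]
      split_ifs with hu
      · subst hu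
        omega
      · simpa using this
    obtain ⟨w, hw, hp⟩ := ih _ (Finset.sum_lt_sum (fun u _ => Nat.sub_le_sub_left
      (Nat.le_add_right (g u) (List.count u [v])) _) ⟨v, Finset.mem_univ v, by
        simp only [hcount, if_true]
        omega⟩) hg' hle rfl
    refine ⟨v :: w, fun u => ?_, fun p hpw => ?_⟩
    · rw [← hw u, ← List.singleton_append, List.count_append, add_assoc]
    · rcases List.prefix_cons_iff.1 hpw with rfl | ⟨t, rfl, ht⟩
      · simpa using hg
      · convert hp t ht using 2 with u
        rw [← List.singleton_append, List.count_append, add_assoc]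

theorem prefix_append_cases {l₁ l₂ p : List V} (h : p <+: l₁ ++ l₂) :
    p <+: l₁ ∨ ∃ t, p = l₁ ++ t ∧ t <+: l₂ := by
  rcases List.prefix_or_prefix_of_prefix h (List.prefix_append l₁ l₂) with k | ⟨t, rfl⟩
  · exact Or.inl k
  · exact Or.inr ⟨t, rfl, (List.prefix_append_right_inj l₁).1 h⟩

theorem IsState.const_add {R : V → V → Prop} {h : V → ℕ} (c : ℕ) (hh : IsState R h) :
    IsState R fun v => c + h v := fun u v huv => by
  have := hh u v huv
  simp only
  omega

/-- A single word passes, up to additive constants, through all states of a given list. -/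
theorem exists_word_through [Finite V] {R : V → V → Prop} {rank : V → ℕ}
    (hR : ∀ u v, R u v → rank u < rank v) (m : ℕ) (l : List (V → ℕ))
    (hl : ∀ h ∈ l, IsState R h ∧ ∀ v, h v ≤ m) :
    ∃ w : List V, (∀ v, w.count v = m * l.length) ∧
      (∀ p, p <+: w → IsState R fun v => p.count v) ∧
      ∀ h ∈ l, ∃ c, ∃ p, p <+: w ∧ ∀ v, p.count v = c + h v := by
  induction l with
  | nil =>
    refine ⟨[], by simp, fun p hp => ?_, by simp⟩
    rw [List.prefix_nil.1 hp]
    intro u v _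
    simp
  | cons h l ih =>
    obtain ⟨w, hw, hst, hwl⟩ := ih fun g hg => hl g (List.mem_cons_of_mem _ hg)
    obtain ⟨hh, hm⟩ := hl h List.mem_cons_self
    have zero : IsState R fun _ => 0 := fun u v _ => by simp
    have top : IsState R fun _ => m := fun u v _ => by simp
    obtain ⟨w₁, hw₁, hs₁⟩ := zero.exists_word hR hh fun v => Nat.zero_le _
    obtain ⟨w₂, hw₂, hs₂⟩ := hh.exists_word hR top hm
    simp only [zero_add] at hw₁ hs₁
    refine ⟨w ++ (w₁ ++ w₂), fun v => ?_, fun p hp => ?_, fun g hg => ?_⟩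
    · rw [List.count_append, List.count_append, hw, hw₁, hw₂, List.length_cons]
      ring
    · rcases prefix_append_cases hp with hp | ⟨t, rfl, ht⟩
      · exact hst p hp
      · simp only [List.count_append, hw]
        refine IsState.const_add _ ?_
        rcases prefix_append_cases ht with ht | ⟨s, rfl, hs⟩
        · exact hs₁ t ht
        · simpa only [List.count_append, hw₁] using hs₂ s hs
    · rcases List.mem_cons.1 hg with rfl | hg
      · refine ⟨m * l.length, w ++ w₁, ⟨w₂, by simp⟩, fun v => ?_⟩
        rw [List.count_append, hw, hw₁]
      · obtain ⟨c, p, hp, hc⟩ := hwl g hg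
        exact ⟨c, p, hp.trans (List.prefix_append _ _), hc⟩

open Relation in
/-- A graph is word-representable if it has an acyclic orientation `R` without shortcuts: whenever
there is an arc from `b` to `a`, the vertices of a directed path from `b` to `a` are pairwise
adjacent. -/
theorem wordRepresentable_of_orientation [Finite V] {G : SimpleGraph V} {R : V → V → Prop}
    {rank : V → ℕ} (hR : ∀ u v, R u v → rank u < rank v)
    (hG : ∀ u v, G.Adj u v ↔ R u v ∨ R v u)
    (hst : ∀ b x y a, R b a → ReflTransGen R b x → ReflTransGen R x y → ReflTransGen R y a →
      x ≠ y → G.Adj x y) : WordRepresentable G := by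
  have hrank : ∀ {u v}, ReflTransGen R u v → rank u ≤ rank v := by
    intro u v h
    induction h with
    | refl => exact le_rfl
    | tail _ h ih => exact ih.trans (hR _ _ h).le
  have key : ∀ x y, x ≠ y → ¬ G.Adj x y →
      ∃ h, IsState R h ∧ (∀ v, h v ≤ 2) ∧ (h x < h y ∨ h y + 2 ≤ h x) := by
    intro x y hxy hadj
    by_cases hp : ReflTransGen R x y
    · -- `h v` is the least number of arcs traversed backwards on a walk from `y` to `v`, capped
      -- at `2`. It is `2` at `x` because there are no shortcuts.
      refine ⟨fun v => if ReflTransGen R y v then 0 else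
        if ∃ a b, ReflTransGen R y a ∧ R b a ∧ ReflTransGen R b v then 1 else 2, ?_, ?_, ?_⟩
      · intro u v huv
        have h₀ : ReflTransGen R y u → ReflTransGen R y v := fun h => h.tail huv
        have h₁ : (∃ a b, ReflTransGen R y a ∧ R b a ∧ ReflTransGen R b u) →
            ∃ a b, ReflTransGen R y a ∧ R b a ∧ ReflTransGen R b v :=
          fun ⟨a, b, k₁, k₂, k₃⟩ => ⟨a, b, k₁, k₂, k₃.tail huv⟩
        have h₂ : ReflTransGen R y v → ∃ a b, ReflTransGen R y a ∧ R b a ∧ ReflTransGen R b u :=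
          fun h => ⟨v, u, h, huv, .refl⟩
        simp only
        split_ifs <;> first | omega | exact absurd (h₀ ‹_›) ‹_› | exact absurd (h₁ ‹_›) ‹_› |
          exact absurd (h₂ ‹_›) ‹_›
      · intro v
        simp only
        split_ifs <;> omega
      · right
        have h₀ : ¬ ReflTransGen R y x := by
          intro h
          rcases ReflTransGen.cases_head hp with e | ⟨z, hz, hzy⟩
          · exact hxy e
          · have := hR _ _ hz
            have := hrank hzy
            have := hrank h
            omega
        have h₁ : ¬ ∃ a b, ReflTransGen R y a ∧ R b a ∧ ReflTransGen R b x :=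
          fun ⟨a, b, k₁, k₂, k₃⟩ => hadj (hst b x y a k₂ k₃ hp k₁ hxy)
        simp only [if_neg h₀, if_neg h₁, if_pos (ReflTransGen.refl (r := R) (a := y))]
        omega
    · refine ⟨fun v => if ReflTransGen R v y then 1 else 0, ?_, ?_, ?_⟩
      · intro u v huv
        have : ReflTransGen R v y → ReflTransGen R u y := fun h => h.head huv
        simp only
        split_ifs <;> first | omega | exact absurd (this ‹_›) ‹_›
      · intro v
        simp only
        split_ifs <;> omega
      · left
        simp only [if_neg hp, if_pos (ReflTransGen.refl (r := R) (a := y))]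
        omega
  choose! f hf hm hv using key
  have := Fintype.ofFinite V
  have zero : IsState R fun _ => 0 := fun u v _ => by simp
  obtain ⟨w, hw, hs, hl⟩ := exists_word_through hR 2
    ((fun _ => 0) :: ((Finset.univ.filter fun q : V × V => q.1 ≠ q.2 ∧ ¬ G.Adj q.1 q.2).toList.map
      fun q => f q.1 q.2)) (by
      simp only [List.mem_cons, List.mem_map, Finset.mem_toList, Finset.mem_filter,
        Finset.mem_univ, true_and]
      rintro h (rfl | ⟨q, ⟨h₁, h₂⟩, rfl⟩)
      · exact ⟨zero, fun v => Nat.zero_le _⟩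
      · exact ⟨hf _ _ h₁ h₂, hm _ _ h₁ h₂⟩)
  refine ⟨w, fun v => ?_, fun x y hxy => ?_⟩
  · rw [← List.count_pos_iff, hw, List.length_cons]
    omega
  · have lead : ∀ {u v}, R u v → Lead w u v := fun huv p hp => hs p hp _ _ huv
    have not_lead : ∀ {u v}, u ≠ v → ¬ G.Adj u v → ¬ Lead w u v := by
      intro u v huv hadj H
      obtain ⟨c, p, hp, hc⟩ := hl (f u v) (List.mem_cons_of_mem _ (List.mem_map.2
        ⟨(u, v), by simp [huv, hadj], rfl⟩))
      have h₁ := H p hp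
      have h₂ := hv u v huv hadj
      rw [hc, hc] at h₁
      omega
    rw [alternate_iff hxy]
    constructor
    · intro H
      by_contra hadj
      rcases H with H | H
      · exact not_lead hxy hadj H
      · exact not_lead hxy.symm (fun h => hadj h.symm) H
    · intro H
      exact ((hG x y).1 H).imp lead lead

end Words

/-! ### Apexes over triangles of a coloured graph -/

open Relation in
/-- Let `K` consist of a properly 3-coloured graph on `U` and of pairwise non-adjacent apexes `c`,
each over a clique of the graph. If different cliques share at most one vertex, and if for each
clique there is at most one vertex outside it that is adjacent to two of its vertices, then `K` is
word-representable.

Edges of the coloured graph are directed from the smaller to the larger colour. An apex becomes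
a source of its clique, unless the outside vertex is adjacent to the vertices of colours `0` and
`2`: then it is placed between the vertices of colours `0` and `1`. -/
theorem wordRepresentable_of_apexes {U S : Type*} [Finite U] [Finite S]
    {K : SimpleGraph (U ⊕ S)} (col : U → ℕ) (hcol : ∀ u, col u < 3)
    (hK : ∀ u v, K.Adj (.inl u) (.inl v) → col u ≠ col v)
    (hS : ∀ c d, ¬ K.Adj (.inr c) (.inr d))
    (hclique : ∀ c u v, K.Adj (.inr c) (.inl u) → K.Adj (.inr c) (.inl v) → u ≠ v →
      K.Adj (.inl u) (.inl v))
    (hshare : ∀ c d u v, K.Adj (.inr c) (.inl u) → K.Adj (.inr c) (.inl v) →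
      K.Adj (.inr d) (.inl u) → K.Adj (.inr d) (.inl v) → u ≠ v → c = d)
    (hout : ∀ c u v w u' v' w', K.Adj (.inr c) (.inl u) → K.Adj (.inr c) (.inl v) → u ≠ v →
      K.Adj (.inl u) (.inl w) → K.Adj (.inl v) (.inl w) → ¬ K.Adj (.inr c) (.inl w) →
      K.Adj (.inr c) (.inl u') → K.Adj (.inr c) (.inl v') → u' ≠ v' →
      K.Adj (.inl u') (.inl w') → K.Adj (.inl v') (.inl w') → ¬ K.Adj (.inr c) (.inl w') →
      w = w') :
    WordRepresentable K := by
  classical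
  -- The apexes that are not made sources.
  let E : S → Prop := fun c => ∃ u v w, K.Adj (.inr c) (.inl u) ∧ K.Adj (.inr c) (.inl v) ∧
    col u = 0 ∧ col v = 2 ∧ K.Adj (.inl u) (.inl w) ∧ K.Adj (.inl v) (.inl w) ∧
    ¬ K.Adj (.inr c) (.inl w)
  -- The arcs go upwards with respect to the following levels: `0` for apexes that are sources, `1`
  -- for colour `0`, `2` for the other apexes, `3` and `4` for the colours `1` and `2`.
  obtain ⟨lev, hl, hr⟩ : ∃ lev : U ⊕ S → ℕ,
      (∀ u, lev (.inl u) = if col u = 0 then 1 else col u + 2) ∧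
      ∀ c, lev (.inr c) = if E c then 2 else 0 :=
    ⟨Sum.elim (fun u => if col u = 0 then 1 else col u + 2) (fun c => if E c then 2 else 0),
      fun _ => rfl, fun _ => rfl⟩
  have lev_inl : ∀ u, lev (.inl u) = 1 ∨ lev (.inl u) = 3 ∨ lev (.inl u) = 4 := by
    intro u
    have := hcol u
    rw [hl]
    split_ifs <;> omega
  have lev_inr : ∀ c, lev (.inr c) = 0 ∨ lev (.inr c) = 2 := by
    intro c
    rw [hr]
    split_ifs <;> omega
  have odd_or : ∀ x, (lev x = 1 ∨ lev x = 3 ∨ lev x = 4) → ∃ u, x = .inl u := by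
    rintro (u | c) h
    · exact ⟨u, rfl⟩
    · have := lev_inr c
      omega
  have even_or : ∀ x, (lev x = 0 ∨ lev x = 2) → ∃ c, x = .inr c := by
    rintro (u | c) h
    · have := lev_inl u
      omega
    · exact ⟨c, rfl⟩
  have lev_le : ∀ x, lev x ≤ 4 := by
    rintro (u | c)
    · have := lev_inl u
      omega
    · have := lev_inr c
      omega
  have clique : ∀ c s t, K.Adj (.inr c) s → K.Adj (.inr c) t → s ≠ t → K.Adj s t := by
    rintro c (s | s) (t | t) h₁ h₂ hne
    · exact hclique c s t h₁ h₂ (by simpa using hne)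
    · exact absurd h₂ (hS _ _)
    · exact absurd h₁ (hS _ _)
    · exact absurd h₁ (hS _ _)
  let R : U ⊕ S → U ⊕ S → Prop := fun x y => K.Adj x y ∧ lev x < lev y
  have mono : ∀ {x y}, ReflTransGen R x y → lev x ≤ lev y := by
    intro x y h
    induction h with
    | refl => exact le_rfl
    | tail _ h ih => exact ih.trans h.2.le
  have head : ∀ {x y}, ReflTransGen R x y → x = y ∨
      ∃ m, K.Adj x m ∧ lev x < lev m ∧ lev m ≤ lev y ∧ ReflTransGen R m y := by
    intro x y h
    rcases ReflTransGen.cases_head h with h | ⟨m, h₁, h₂⟩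
    · exact Or.inl h
    · exact Or.inr ⟨m, h₁.1, h₁.2, mono h₂, h₂⟩
  have same : ∀ {x y}, ReflTransGen R x y → lev y ≤ lev x → x = y := by
    intro x y h hle
    rcases head h with h | ⟨m, -, h₁, h₂, -⟩
    · exact h
    · omega
  have step : ∀ {x y}, ReflTransGen R x y → lev x < lev y → lev y ≤ lev x + 1 → K.Adj x y := by
    intro x y h hlt hle
    rcases head h with rfl | ⟨m, h₀, h₁, h₂, h₃⟩
    · omega
    · obtain rfl := same h₃ (by omega)
      exact h₀
  have ne_of_lt : ∀ {x y}, lev x < lev y → x ≠ y := by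
    rintro x y h rfl
    omega
  -- Directed paths between the levels that are not consecutive.
  have path₁₃ : ∀ {x y}, ReflTransGen R x y → lev x = 1 → lev y = 3 → K.Adj x y := by
    intro x y h hx hy
    rcases head h with rfl | ⟨m, h₀, h₁, h₂, h₃⟩
    · omega
    · by_cases hm : lev m = 2
      · obtain ⟨c, rfl⟩ := even_or m (by omega)
        exact clique c x y h₀.symm (step h₃ (by omega) (by omega)) (ne_of_lt (by omega))
      · obtain rfl := same h₃ (by omega)
        exact h₀
  have path₂₄ : ∀ {x y}, ReflTransGen R x y → lev x = 2 → lev y = 4 →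
      K.Adj x y ∨ ∃ m, lev m = 3 ∧ K.Adj x m ∧ K.Adj m y := by
    intro x y h hx hy
    rcases head h with rfl | ⟨m, h₀, h₁, h₂, h₃⟩
    · omega
    · by_cases hm : lev m = 3
      · exact Or.inr ⟨m, hm, h₀, step h₃ (by omega) (by omega)⟩
      · obtain rfl := same h₃ (by omega)
        exact Or.inl h₀
  have path₀₃ : ∀ {x y}, ReflTransGen R x y → lev x = 0 → lev y = 3 →
      K.Adj x y ∨ ∃ m, lev m = 1 ∧ K.Adj x m ∧ K.Adj m y := by
    intro x y h hx hy
    rcases head h with rfl | ⟨m, h₀, h₁, h₂, h₃⟩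
    · omega
    · by_cases hm : lev m = 3
      · obtain rfl := same h₃ (by omega)
        exact Or.inl h₀
      · by_cases hm' : lev m = 2
        · obtain ⟨c, rfl⟩ := even_or m (by omega)
          obtain ⟨d, rfl⟩ := even_or x (by omega)
          exact absurd h₀ (hS _ _)
        · exact Or.inr ⟨m, by omega, h₀, path₁₃ h₃ (by omega) hy⟩
  -- If the outside vertex is adjacent to the vertices of colours `0` and `2`, the apex is not a
  -- source.
  have source : ∀ {c s t m}, lev (.inr c) = 0 → lev s = 1 → lev t = 4 → lev m = 3 →
      K.Adj (.inr c) s → K.Adj (.inr c) t → K.Adj s m → K.Adj m t → K.Adj (.inr c) m := by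
    intro c s t m hc hs ht hm h₁ h₂ h₃ h₄
    by_contra h₅
    obtain ⟨u, rfl⟩ := odd_or s (by omega)
    obtain ⟨v, rfl⟩ := odd_or t (by omega)
    obtain ⟨w, rfl⟩ := odd_or m (by omega)
    rw [hl] at hs ht
    have hu : col u = 0 := by split_ifs at hs <;> omega
    have hv : col v = 2 := by split_ifs at ht <;> omega
    rw [hr, if_pos ⟨u, v, w, h₁, h₂, hu, hv, h₃, h₄.symm, h₅⟩] at hc
    omega
  -- If the apex is no source, no outside vertex is adjacent to the vertices of colours `0` and `1`.
  have inner : ∀ {c s t m}, lev (.inr c) = 2 → lev s = 1 → lev t = 4 → lev m = 3 →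
      K.Adj (.inr c) s → K.Adj (.inr c) m → K.Adj s t → K.Adj m t → K.Adj (.inr c) t := by
    intro c s t m hc hs ht hm h₁ h₂ h₃ h₄
    by_contra h₅
    have hsm := ne_of_lt (x := s) (y := m) (by omega)
    obtain ⟨u, rfl⟩ := odd_or s (by omega)
    obtain ⟨v, rfl⟩ := odd_or t (by omega)
    obtain ⟨w, rfl⟩ := odd_or m (by omega)
    rw [hl] at ht
    have hv : col v = 2 := by split_ifs at ht <;> omega
    have hE : E c := by
      by_contra hE
      rw [hr, if_neg hE] at hc
      omega
    obtain ⟨u', v', w', k₁, k₂, k₃, k₄, k₅, k₆, k₇⟩ := hE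
    obtain rfl := hout c u w v u' v' w' h₁ h₂ (by simpa using hsm) h₃ h₄ h₅ k₁ k₂
      (by rintro rfl; omega) k₅ k₆ k₇
    exact hK _ _ k₆ (k₄.trans hv.symm)
  have share : ∀ {c d s t}, K.Adj (.inr c) s → K.Adj (.inr c) t → K.Adj (.inr d) s →
      K.Adj (.inr d) t → s ≠ t → c = d := by
    rintro c d (u | u) (v | v) h₁ h₂ h₃ h₄ hne
    · exact hshare c d u v h₁ h₂ h₃ h₄ (by simpa using hne)
    all_goals first | exact absurd h₁ (hS _ _) | exact absurd h₂ (hS _ _)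
  have bottom : ∀ {c a v}, lev (.inr c) = 0 → K.Adj (.inr c) a → ReflTransGen R (.inr c) v →
      ReflTransGen R v a → v ≠ .inr c → K.Adj (.inr c) v := by
    intro c a v hc ha hcv hva hne
    have hv₀ : lev v ≠ 0 := fun h => hne (same hcv (by omega)).symm
    have hv := lev_le v
    have hav := mono hva
    have ha' := lev_le a
    by_cases h₁ : lev v = 1
    · exact step hcv (by omega) (by omega)
    by_cases h₄ : lev v = 4
    · obtain rfl := same hva (by omega)
      exact ha
    by_cases h₃ : lev v = 3
    · rcases path₀₃ hcv hc h₃ with h | ⟨m, k₁, k₂, k₃⟩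
      · exact h
      · by_cases hla : lev a = 3
        · obtain rfl := same hva (by omega)
          exact ha
        · exact source hc k₁ (by omega) h₃ k₂ ha k₃ (step hva (by omega) (by omega))
    exfalso
    obtain ⟨d, rfl⟩ := even_or v (by omega)
    have hcd : c ≠ d := by
      rintro rfl
      exact hne rfl
    rcases head hcv with h | ⟨m, k₀, k₁, k₂, k₃⟩
    · exact hne h.symm
    have hm : lev m = 1 := by
      by_contra hm
      obtain ⟨e, rfl⟩ := even_or m (by omega)
      exact hS _ _ k₀
    have hdm := (step k₃ (by omega) (by omega)).symm
    have hla : lev a ≠ 2 := by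
      intro h
      obtain ⟨e, rfl⟩ := even_or a (by omega)
      exact hS _ _ ha
    have hma := ne_of_lt (x := m) (y := a) (by omega)
    by_cases hla' : lev a = 3
    · exact hcd (share k₀ ha hdm (step hva (by omega) (by omega)) hma)
    rcases path₂₄ hva (by omega) (by omega) with h | ⟨m', l₀, l₁, l₂⟩
    · exact hcd (share k₀ ha hdm h hma)
    · have hmm := ne_of_lt (x := m) (y := m') (by omega)
      exact hcd (share k₀ (source hc hm (by omega) l₀ k₀ ha (clique d _ _ hdm l₁ hmm) l₂)
        hdm l₁ hmm)
  refine wordRepresentable_of_orientation (R := R) (rank := lev) (fun u v h => h.2)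
    (fun u v => ⟨fun h => ?_, ?_⟩) ?_
  · rcases lt_trichotomy (lev u) (lev v) with h' | h' | h'
    · exact Or.inl ⟨h, h'⟩
    · exfalso
      rcases u with u | c <;> rcases v with v | d
      · have h₁ := hK u v h
        rw [hl, hl] at h'
        split_ifs at h' <;> omega
      · have := lev_inl u
        have := lev_inr d
        omega
      · have := lev_inl v
        have := lev_inr c
        omega
      · exact hS _ _ h
    · exact Or.inr ⟨h.symm, h'⟩
  · rintro (h | h)
    · exact h.1
    · exact h.1.symm
  · intro b x y a hba hbx hxy hya hne
    have h₁ := mono hbx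
    have h₂ := mono hxy
    have h₃ := mono hya
    have h₄ := lev_le a
    have lxy : lev x < lev y := lt_of_not_ge fun h => hne (same hxy h)
    by_cases hb : lev b = 0
    · obtain ⟨c, rfl⟩ := even_or b (by omega)
      have hcy := bottom hb hba.1 (hbx.trans hxy) hya (ne_of_lt (by omega)).symm
      by_cases hxb : x = .inr c
      · exact hxb ▸ hcy
      · exact clique c x y (bottom hb hba.1 hbx (hxy.trans hya) hxb) hcy hne
    by_cases ls : lev y ≤ lev x + 1
    · exact step hxy lxy ls
    by_cases l₁₃ : lev x = 1 ∧ lev y = 3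
    · exact path₁₃ hxy l₁₃.1 l₁₃.2
    obtain rfl := same hya (by omega)
    by_cases lb : lev x = lev b
    · obtain rfl := same hbx (by omega)
      exact hba.1
    · rcases path₂₄ hxy (by omega) (by omega) with h | ⟨m, k₀, k₁, k₂⟩
      · exact h
      · obtain ⟨c, rfl⟩ := even_or x (by omega)
        exact inner (by omega) (by omega) (by omega) k₀ (step hbx (by omega) (by omega)).symm k₁
          hba.1 k₂

/-! ### The geometry of the gasket -/

theorem Cell.mem_verts_up {x y : ℤ} {u : ℤ × ℤ} :
    u ∈ (Cell.up x y).verts ↔ x ≤ u.1 ∧ y ≤ u.2 ∧ u.1 + u.2 ≤ x + y + 1 := by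
  obtain ⟨a, b⟩ := u
  simp only [Cell.verts, Finset.mem_insert, Finset.mem_singleton, Prod.mk.injEq]
  omega

theorem Cell.mem_verts_down {x y : ℤ} {u : ℤ × ℤ} :
    u ∈ (Cell.down x y).verts ↔ u.1 ≤ x + 1 ∧ u.2 ≤ y + 1 ∧ x + y + 1 ≤ u.1 + u.2 := by
  obtain ⟨a, b⟩ := u
  simp only [Cell.verts, Finset.mem_insert, Finset.mem_singleton, Prod.mk.injEq]
  omega

/-- The gasket is specified by upward cells, whose coordinates are never both odd: this is the shape
of the last stage of the recursion, read from the smallest scale. -/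
theorem exists_up_of_mem_gasketCells {n : ℕ} {c : Cell} (hc : c ∈ gasketCells n) :
    ∃ x y, c = .up x y ∧ ¬ (x % 2 = 1 ∧ y % 2 = 1) := by
  induction n generalizing c with
  | zero => exact ⟨0, 0, by simpa [gasketCells] using hc, by simp⟩
  | succ n ih =>
    cases n with
    | zero =>
      simp only [gasketCells, Finset.mem_union, Finset.mem_image, Finset.mem_singleton,
        exists_eq_left, Cell.shift] at hc
      rcases hc with (rfl | rfl) | rfl <;> exact ⟨_, _, rfl, by norm_num⟩
    | succ n =>
      have hpow : (2 : ℤ) ^ (n + 1) = 2 * 2 ^ n := by ring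
      rw [gasketCells] at hc
      simp only [Finset.mem_union, Finset.mem_image] at hc
      rcases hc with (hc | ⟨d, hd, rfl⟩) | ⟨d, hd, rfl⟩
      · exact ih hc
      · obtain ⟨x, y, rfl, h⟩ := ih hd
        exact ⟨_, _, rfl, by omega⟩
      · obtain ⟨x, y, rfl, h⟩ := ih hd
        exact ⟨_, _, rfl, by omega⟩

theorem not_odd_of_up_mem {n : ℕ} {x y : ℤ} (h : Cell.up x y ∈ gasketCells n) :
    ¬ (x % 2 = 1 ∧ y % 2 = 1) := by
  obtain ⟨a, b, e, h⟩ := exists_up_of_mem_gasketCells h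
  cases e
  exact h

theorem SG_adj {n : ℕ} {u v : ℤ × ℤ} : (SG n).Adj u v ↔ u ≠ v ∧
    ∃ x y, Cell.up x y ∈ gasketCells n ∧ (x ≤ u.1 ∧ y ≤ u.2 ∧ u.1 + u.2 ≤ x + y + 1) ∧
      (x ≤ v.1 ∧ y ≤ v.2 ∧ v.1 + v.2 ≤ x + y + 1) := by
  refine and_congr_right fun _ => ⟨?_, ?_⟩
  · rintro ⟨c, hc, hu, hv⟩
    obtain ⟨x, y, rfl, -⟩ := exists_up_of_mem_gasketCells hc
    exact ⟨x, y, hc, Cell.mem_verts_up.1 hu, Cell.mem_verts_up.1 hv⟩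
  · rintro ⟨x, y, hc, hu, hv⟩
    exact ⟨_, hc, Cell.mem_verts_up.2 hu, Cell.mem_verts_up.2 hv⟩

theorem mem_cells_SG_of_mem {n : ℕ} {c : Cell} (hc : c ∈ gasketCells n) : c ∈ cells (SG n) :=
  fun _ hu _ hv h => ⟨h, c, hc, hu, hv⟩

/-- An edge lies in exactly one upward cell of the tiling, so that an edge of the gasket determines
a specified cell. -/
theorem up_mem_of_adj {n : ℕ} {u v : ℤ × ℤ} (h : (SG n).Adj u v) {x y : ℤ}
    (hu : u ∈ (Cell.up x y).verts) (hv : v ∈ (Cell.up x y).verts) :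
    Cell.up x y ∈ gasketCells n := by
  obtain ⟨hne, a, b, hc, h₁, h₂⟩ := SG_adj.1 h
  rw [Cell.mem_verts_up] at hu hv
  have hne' : u.1 ≠ v.1 ∨ u.2 ≠ v.2 := by
    by_contra hh
    exact hne (Prod.ext (by tauto) (by tauto))
  obtain ⟨rfl, rfl⟩ : a = x ∧ b = y := by omega
  exact hc

theorem up_mem_cells_SG {n : ℕ} {x y : ℤ} :
    Cell.up x y ∈ cells (SG n) ↔ Cell.up x y ∈ gasketCells n := by
  refine ⟨fun h => ?_, mem_cells_SG_of_mem⟩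
  have h₁ : (x, y) ∈ (Cell.up x y).verts := by simp [Cell.verts]
  have h₂ : (x + 1, y) ∈ (Cell.up x y).verts := by simp [Cell.verts]
  exact up_mem_of_adj (h _ h₁ _ h₂ (by simp)) h₁ h₂

theorem down_mem_cells_SG {n : ℕ} {x y : ℤ} (h : Cell.down x y ∈ cells (SG n)) :
    Cell.up x y ∈ gasketCells n ∧ Cell.up (x + 1) y ∈ gasketCells n ∧
      Cell.up x (y + 1) ∈ gasketCells n := by
  have h₁ : (x + 1, y) ∈ (Cell.down x y).verts := by simp [Cell.verts]
  have h₂ : (x, y + 1) ∈ (Cell.down x y).verts := by simp [Cell.verts]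
  have h₃ : (x + 1, y + 1) ∈ (Cell.down x y).verts := by simp [Cell.verts]
  exact ⟨up_mem_of_adj (h _ h₁ _ h₂ (by simp)) (by simp [Cell.verts]) (by simp [Cell.verts]),
    up_mem_of_adj (h _ h₁ _ h₃ (by simp)) (by simp [Cell.verts]) (by simp [Cell.verts]),
    up_mem_of_adj (h _ h₂ _ h₃ (by simp)) (by simp [Cell.verts]) (by simp [Cell.verts])⟩

/-- The boundary cells of the gasket are the specified cells: by parity, at least one of the two
downward cells to the left and to the right of a specified cell does not belong to the gasket. -/
theorem boundaryCells_SG (n : ℕ) : boundaryCells (SG n) = ↑(gasketCells n) := by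
  ext c
  rw [Finset.mem_coe]
  constructor
  · rintro ⟨hc, u, hu, v, hv, huv, d, hdu, hdv, hd⟩
    rcases c with ⟨x, y⟩ | ⟨x, y⟩
    · exact up_mem_cells_SG.1 hc
    · exfalso
      rcases d with ⟨a, b⟩ | ⟨a, b⟩
      · exact hd (mem_cells_SG_of_mem (up_mem_of_adj huv hdu hdv))
      · rw [Cell.mem_verts_down] at hu hv hdu hdv
        have hne : u.1 ≠ v.1 ∨ u.2 ≠ v.2 := by
          by_contra hh
          exact huv.ne (Prod.ext (by tauto) (by tauto))
        obtain ⟨rfl, rfl⟩ : a = x ∧ b = y := by omega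
        exact hd hc
  · intro hc
    refine ⟨mem_cells_SG_of_mem hc, ?_⟩
    obtain ⟨x, y, rfl, hxy⟩ := exists_up_of_mem_gasketCells hc
    by_cases hx : x % 2 = 1
    · have h₁ : (x + 1, y) ∈ (Cell.up x y).verts := by simp [Cell.verts]
      have h₂ : (x, y + 1) ∈ (Cell.up x y).verts := by simp [Cell.verts]
      refine ⟨_, h₁, _, h₂, ⟨by simp, _, hc, h₁, h₂⟩, .down x y, by simp [Cell.verts],
        by simp [Cell.verts], fun h => ?_⟩
      have := not_odd_of_up_mem (down_mem_cells_SG h).2.2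
      omega
    · have h₁ : (x, y) ∈ (Cell.up x y).verts := by simp [Cell.verts]
      have h₂ : (x, y + 1) ∈ (Cell.up x y).verts := by simp [Cell.verts]
      refine ⟨_, h₁, _, h₂, ⟨by simp, _, hc, h₁, h₂⟩, .down (x - 1) y, by simp [Cell.verts],
        by simp [Cell.verts], fun h => ?_⟩
      have h₃ := not_odd_of_up_mem (down_mem_cells_SG h).1
      have h₄ := not_odd_of_up_mem (down_mem_cells_SG h).2.2
      omega

/-- A vertex `w` outside a specified cell that is adjacent to two vertices of the cell is determined
by the cell: it is the third vertex of the adjacent downward cell, and only one of the three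
adjacent downward cells can belong to the gasket, by parity. -/
theorem outside_vertex_eq {n : ℕ} {x y : ℤ} (hc : Cell.up x y ∈ gasketCells n) {u v w : ℤ × ℤ}
    (hu : u ∈ (Cell.up x y).verts) (hv : v ∈ (Cell.up x y).verts) (huv : u ≠ v)
    (huw : (SG n).Adj u w) (hvw : (SG n).Adj v w) (hw : w ∉ (Cell.up x y).verts) :
    w = if x % 2 = 1 then (x - 1, y + 1) else if y % 2 = 1 then (x + 1, y - 1)
      else (x + 1, y + 1) := by
  obtain ⟨-, a, b, hab, h₁, h₂⟩ := SG_adj.1 huw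
  obtain ⟨-, a', b', hab', h₃, h₄⟩ := SG_adj.1 hvw
  rw [Cell.mem_verts_up] at hw
  obtain ⟨s, t⟩ := w
  simp only [Cell.verts, Finset.mem_insert, Finset.mem_singleton] at hu hv
  dsimp only at h₂ h₄ hw
  -- The position of `w` follows without parity; the specified cells on the edges at `w` then
  -- restrict the parity.
  have pos : (s = x - 1 ∧ t = y + 1 ∧ Cell.up (x - 1) y ∈ gasketCells n ∧
        Cell.up (x - 1) (y + 1) ∈ gasketCells n) ∨
      (s = x + 1 ∧ t = y - 1 ∧ Cell.up x (y - 1) ∈ gasketCells n ∧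
        Cell.up (x + 1) (y - 1) ∈ gasketCells n) ∨
      (s = x + 1 ∧ t = y + 1 ∧ Cell.up (x + 1) y ∈ gasketCells n ∧
        Cell.up x (y + 1) ∈ gasketCells n) := by
    rcases hu with rfl | rfl | rfl <;> rcases hv with rfl | rfl | rfl <;> dsimp only at h₁ h₃ <;>
    first
    | exact absurd rfl huv
    | (have e : s = x - 1 ∧ t = y + 1 ∧ a = x - 1 ∧ b = y ∧ a' = x - 1 ∧ b' = y + 1 := by
         omega
       obtain ⟨e₁, e₂, e₃, e₄, e₅, e₆⟩ := e
       exact Or.inl ⟨e₁, e₂, e₃ ▸ e₄ ▸ hab, e₅ ▸ e₆ ▸ hab'⟩)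
    | (have e : s = x - 1 ∧ t = y + 1 ∧ a' = x - 1 ∧ b' = y ∧ a = x - 1 ∧ b = y + 1 := by
         omega
       obtain ⟨e₁, e₂, e₃, e₄, e₅, e₆⟩ := e
       exact Or.inl ⟨e₁, e₂, e₃ ▸ e₄ ▸ hab', e₅ ▸ e₆ ▸ hab⟩)
    | (have e : s = x + 1 ∧ t = y - 1 ∧ a = x ∧ b = y - 1 ∧ a' = x + 1 ∧ b' = y - 1 := by
         omega
       obtain ⟨e₁, e₂, e₃, e₄, e₅, e₆⟩ := e
       exact Or.inr (Or.inl ⟨e₁, e₂, e₃ ▸ e₄ ▸ hab, e₅ ▸ e₆ ▸ hab'⟩))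
    | (have e : s = x + 1 ∧ t = y - 1 ∧ a' = x ∧ b' = y - 1 ∧ a = x + 1 ∧ b = y - 1 := by
         omega
       obtain ⟨e₁, e₂, e₃, e₄, e₅, e₆⟩ := e
       exact Or.inr (Or.inl ⟨e₁, e₂, e₃ ▸ e₄ ▸ hab', e₅ ▸ e₆ ▸ hab⟩))
    | (have e : s = x + 1 ∧ t = y + 1 ∧ a = x + 1 ∧ b = y ∧ a' = x ∧ b' = y + 1 := by
         omega
       obtain ⟨e₁, e₂, e₃, e₄, e₅, e₆⟩ := e
       exact Or.inr (Or.inr ⟨e₁, e₂, e₃ ▸ e₄ ▸ hab, e₅ ▸ e₆ ▸ hab'⟩))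
    | (have e : s = x + 1 ∧ t = y + 1 ∧ a' = x + 1 ∧ b' = y ∧ a = x ∧ b = y + 1 := by
         omega
       obtain ⟨e₁, e₂, e₃, e₄, e₅, e₆⟩ := e
       exact Or.inr (Or.inr ⟨e₁, e₂, e₃ ▸ e₄ ▸ hab', e₅ ▸ e₆ ▸ hab⟩))
  have k := not_odd_of_up_mem hc
  rcases pos with ⟨rfl, rfl, h, h'⟩ | ⟨rfl, rfl, h, h'⟩ | ⟨rfl, rfl, h, h'⟩ <;>
  · have k₁ := not_odd_of_up_mem h
    have k₂ := not_odd_of_up_mem h'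
    clear hu hv h₁ h₂ h₃ h₄ hw
    split_ifs <;> first | rfl | omega

/-! ### Subdivisions of the gasket -/

theorem wordRepresentable_subdivision_SG {n : ℕ} {S : Set Cell} (hS : S ⊆ ↑(gasketCells n)) :
    WordRepresentable (subdivision (SG n) S) := by
  have hfin : (SG n).verts.Finite :=
    ((gasketCells n).biUnion Cell.verts).finite_toSet.subset fun u ⟨c, hc, hu⟩ => by
      simpa using ⟨c, hc, hu⟩
  have : Finite (SG n).verts := hfin
  have : Finite S := (gasketCells n).finite_toSet.subset hS
  have hup : ∀ c : S, ∃ x y, (c : Cell) = .up x y ∧ Cell.up x y ∈ gasketCells n := by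
    intro c
    have hc : (c : Cell) ∈ gasketCells n := hS c.2
    obtain ⟨x, y, h, -⟩ := exists_up_of_mem_gasketCells hc
    exact ⟨x, y, h, h ▸ hc⟩
  refine wordRepresentable_of_apexes
    (fun u => (((u : ℤ × ℤ).1 - (u : ℤ × ℤ).2) % 3).toNat) (fun u => by omega) ?_ ?_ ?_ ?_ ?_
  · intro u v h
    obtain ⟨hne, x, y, -, h₁, h₂⟩ := SG_adj.1 (show (SG n).Adj u v from h)
    have hne' : (u : ℤ × ℤ).1 ≠ (v : ℤ × ℤ).1 ∨ (u : ℤ × ℤ).2 ≠ (v : ℤ × ℤ).2 := by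
      by_contra hh
      exact hne (Prod.ext (by tauto) (by tauto))
    omega
  · exact fun _ _ h => h
  · intro c u v hu hv hne
    exact ⟨fun h => hne (Subtype.ext h), c, hS c.2, hu, hv⟩
  · intro c d u v h₁ h₂ h₃ h₄ hne
    obtain ⟨x, y, hc, hxy⟩ := hup c
    obtain ⟨a, b, hd, -⟩ := hup d
    have h : (SG n).Adj u v := ⟨fun h => hne (Subtype.ext h), c, hS c.2, h₁, h₂⟩
    have hne' : (u : ℤ × ℤ).1 ≠ (v : ℤ × ℤ).1 ∨ (u : ℤ × ℤ).2 ≠ (v : ℤ × ℤ).2 := by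
      by_contra hh
      exact h.ne (Prod.ext (by tauto) (by tauto))
    change (u : ℤ × ℤ) ∈ (c : Cell).verts at h₁
    change (v : ℤ × ℤ) ∈ (c : Cell).verts at h₂
    change (u : ℤ × ℤ) ∈ (d : Cell).verts at h₃
    change (v : ℤ × ℤ) ∈ (d : Cell).verts at h₄
    rw [hc, Cell.mem_verts_up] at h₁ h₂
    rw [hd, Cell.mem_verts_up] at h₃ h₄
    obtain ⟨rfl, rfl⟩ : a = x ∧ b = y := by omega
    exact Subtype.ext (hc.trans hd.symm)
  · intro c u v w u' v' w' h₁ h₂ hne h₃ h₄ h₅ k₁ k₂ hne' k₃ k₄ k₅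
    obtain ⟨x, y, hc, hxy⟩ := hup c
    have mem : ∀ {s : (SG n).verts}, (subdivision (SG n) S).Adj (.inr c) (.inl s) ↔
        (s : ℤ × ℤ) ∈ (Cell.up x y).verts := by
      intro s
      rw [← hc]
      rfl
    rw [mem] at h₁ h₂ h₅ k₁ k₂ k₅
    exact Subtype.ext ((outside_vertex_eq hxy h₁ h₂ (fun h => hne (Subtype.ext h)) h₃ h₄ h₅).trans
      (outside_vertex_eq hxy k₁ k₂ (fun h => hne' (Subtype.ext h)) k₃ k₄ k₅).symm)

theorem not_wordRepresentable_subdivision_SG {n : ℕ} {S : Set Cell} {x y : ℤ}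
    (hS : Cell.down x y ∈ S) (hc : Cell.down x y ∈ cells (SG n)) :
    ¬ WordRepresentable (subdivision (SG n) S) := by
  obtain ⟨h₁, h₂, h₃⟩ := down_mem_cells_SG hc
  have vert : ∀ {s t : ℤ}, Cell.up s t ∈ gasketCells n → ∀ u ∈ (Cell.up s t).verts,
      u ∈ (SG n).verts := fun h u hu => ⟨_, h, hu⟩
  let a : (SG n).verts := ⟨(x + 1, y), vert h₁ _ (by simp [Cell.verts])⟩
  let b : (SG n).verts := ⟨(x, y + 1), vert h₁ _ (by simp [Cell.verts])⟩
  let c : (SG n).verts := ⟨(x + 1, y + 1), vert h₂ _ (by simp [Cell.verts])⟩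
  let p : (SG n).verts := ⟨(x + 2, y), vert h₂ _ (by simp [Cell.verts]; omega)⟩
  let q : (SG n).verts := ⟨(x, y), vert h₁ _ (by simp [Cell.verts])⟩
  let r : (SG n).verts := ⟨(x, y + 2), vert h₃ _ (by simp [Cell.verts]; omega)⟩
  have adj₁ : ∀ {s t : ℤ}, Cell.up s t ∈ gasketCells n → ∀ u v : (SG n).verts,
      (u : ℤ × ℤ) ∈ (Cell.up s t).verts → (v : ℤ × ℤ) ∈ (Cell.up s t).verts →
      (u : ℤ × ℤ) ≠ v → (subdivision (SG n) S).Adj (.inl u) (.inl v) :=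
    fun h u v hu hv hne => ⟨hne, _, h, hu, hv⟩
  have far : ∀ u v : (SG n).verts, ¬ tiling.Adj u v →
      ¬ (subdivision (SG n) S).Adj (.inl u) (.inl v) := fun u v h h' => h ((SG n).adj_sub h')
  have apex : ∀ u : (SG n).verts, (u : ℤ × ℤ) ∈ (Cell.down x y).verts →
      (subdivision (SG n) S).Adj (.inr ⟨_, hS⟩) (.inl u) := fun u h => h
  have apex' : ∀ u : (SG n).verts, (u : ℤ × ℤ) ∉ (Cell.down x y).verts →
      ¬ (subdivision (SG n) S).Adj (.inl u) (.inr ⟨_, hS⟩) := fun u h h' => h h'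
  refine not_wordRepresentable_of_clique (a := .inl a) (b := .inl b) (c := .inl c)
    (d := .inr ⟨_, hS⟩) (x := .inl p) (y := .inl q) (z := .inl r)
    (adj₁ h₁ a b ?_ ?_ ?_) (adj₁ h₂ a c ?_ ?_ ?_) (adj₁ h₃ b c ?_ ?_ ?_)
    (apex a ?_) (apex b ?_) (apex c ?_)
    (adj₁ h₂ p a ?_ ?_ ?_) (adj₁ h₂ p c ?_ ?_ ?_) (far p b ?_) (apex' p ?_)
    (adj₁ h₁ q a ?_ ?_ ?_) (adj₁ h₁ q b ?_ ?_ ?_) (far q c ?_) (apex' q ?_)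
    (adj₁ h₃ r b ?_ ?_ ?_) (adj₁ h₃ r c ?_ ?_ ?_) (far r a ?_) (apex' r ?_)
  all_goals first
    | (rw [Cell.mem_verts_up]; dsimp only [a, b, c, p, q, r]; omega)
    | (rw [Cell.mem_verts_down]; dsimp only [a, b, c, p, q, r]; omega)
    | (dsimp only [a, b, c, p, q, r, tiling]; ring_nf; norm_num)

end TriGrid

theorem mainTheorem3 (n : ℕ) :
    (∀ S : Set TriGrid.Cell, S ⊆ TriGrid.boundaryCells (TriGrid.SG n) →
      TriGrid.WordRepresentable (TriGrid.subdivision (TriGrid.SG n) S)) ∧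
    TriGrid.IsMaximumWordRepSubdivision (TriGrid.SG n)
      (TriGrid.boundaryCells (TriGrid.SG n)) := by
  have rep : ∀ S : Set TriGrid.Cell, S ⊆ TriGrid.boundaryCells (TriGrid.SG n) →
      TriGrid.WordRepresentable (TriGrid.subdivision (TriGrid.SG n) S) := fun S hS =>
    TriGrid.wordRepresentable_subdivision_SG (TriGrid.boundaryCells_SG n ▸ hS)
  have non : ∀ c ∈ TriGrid.cells (TriGrid.SG n), c ∉ TriGrid.boundaryCells (TriGrid.SG n) →
      ∀ T : Set TriGrid.Cell, c ∈ T →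
        ¬ TriGrid.WordRepresentable (TriGrid.subdivision (TriGrid.SG n) T) := by
    intro c hc hb T hT
    rcases c with ⟨x, y⟩ | ⟨x, y⟩
    · rw [TriGrid.boundaryCells_SG] at hb
      exact absurd (TriGrid.up_mem_cells_SG.1 hc) hb
    · exact TriGrid.not_wordRepresentable_subdivision_SG hT hc
  have sub : ∀ T : Set TriGrid.Cell, TriGrid.IsWordRepSubdivision (TriGrid.SG n) T →
      T ⊆ TriGrid.boundaryCells (TriGrid.SG n) := by
    intro T hT c hc
    by_contra hb
    exact non c (hT.1 hc) hb T hc hT.2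
  refine ⟨rep, ⟨⟨fun c hc => hc.1, rep _ subset_rfl⟩, fun c hc hb =>
    non c hc hb _ (Set.mem_insert _ _)⟩, fun T hT => ?_, sub⟩
  refine (sub T hT.1).antisymm fun c hc => ?_
  by_contra hcT
  exact hT.2 c hc.1 hcT (rep _ (Set.insert_subset hc (sub T hT.1)))
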